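/- Let $d,n$ be integers with $1\le n\le d-1$, write $x=(y,z)\in\mathbb{R}^n\times\mathbb{R}^{d-n}=\mathbb{R}^d$, and let $\sigma$ be real with $\frac{2}{d-n}<\sigma<\frac{2}{d-2}$ (no upper bound if $d=2$). Let $$B_1=\{u\in H^1(\mathbb{R}^d;\mathbb{C}) : |y|u\in L^2(\mathbb{R}^d)\},\qquad \|u\|_{B_1}^2=\|\nabla_x u\|_{L^2}^2+\|yu\|_{L^2}^2+\|u\|_{L^2}^2,$$ and for $u\in B_1$ let $$S(u)=\tfrac12\|\nabla_x u\|_{L^2}^2+\tfrac12\|yu\|_{L^2}^2+\tfrac12\|u\|_{L^2}^2-\tfrac{1}{2\sigma+2}\|u\|_{L^{2\sigma+2}}^{2\sigma+2},$$ $$I(u)=\|\nabla_x u\|_{L^2}^2+\|yu\|_{L^2}^2+\|u\|_{L^2}^2-\|u\|_{L^{2\sigma+2}}^{2\sigma+2},\qquad P(u)=\tfrac{2}{d-n}\|\nabla_z u\|_{L^2}^2-\tfrac{\sigma}{\sigma+1}\|u\|_{L^{2\sigma+2}}^{2\sigma+2}.$$ Let $\beta=\inf_{\gamma\in\Gamma}\max_{s\in[0,1]}S(\gamma(s))$,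 where $\Gamma=\{\gamma\in C([0,1];B_1):\gamma(0)=0,\ S(\gamma(1))<0\}$. Call $(a,b)\in\mathbb{R}^2$ admissible if $$a>0,\quad b\le 0,\quad 2a+b(d-n)\ge 0,\quad \sigma a+b>0,\quad (a,b)\ne(0,0),$$ and put $$\varphi_\lambda^{a,b}(y,z)=e^{a\lambda}\varphi(y,e^{-b\lambda}z),\qquad J^{a,b}(\varphi)=\partial_\lambda S(\varphi_\lambda^{a,b})\big|_{\lambda=0},$$ $$\mathcal K^{a,b,+}=\{\varphi\in B_1: S(\varphi)<\beta,\ J^{a,b}(\varphi)\ge 0\},\qquad \mathcal K^{a,b,-}=\{\varphi\in B_1: S(\varphi)<\beta,\ J^{a,b}(\varphi)<0\}.$$ Then $\mathcal K^{a,b,+}=\mathcal K^{a',b',+}$ and $\mathcal K^{a,b,-}=\mathcal K^{a',b',-}$ for all admissible pairs $(a,b)$ and $(a',b')$. Moreover, for every $\varphi\in B_1$ with $S(\varphi)<\beta$, the numbers $I(\varphi)$ and $P(\varphi)$ have the same sign (both positive, both negative, or both zero). -/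

import Mathlib

open MeasureTheory
open scoped ContDiff

namespace PartialNLS

/-- Points `x = (y, z)` of `ℝ^d`: the first `n` coordinates form `y ∈ ℝ^n` and the remaining `d - n`
coordinates form `z ∈ ℝ^(d-n)`. -/
abbrev Space (d : ℕ) : Type := EuclideanSpace ℝ (Fin d)

/-- `|y|` for `x = (y, z)`. -/
noncomputable def normY (d n : ℕ) (x : Space d) : ℝ :=
  Real.sqrt (∑ i : Fin d, if (i : ℕ) < n then x i ^ 2 else 0)

/-- `g` is the weak (distributional) partial derivative `∂_i u`. -/
def HasWeakPartial {d : ℕ} (i : Fin d) (u g : Space d → ℂ) : Prop :=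
  ∀ φ : Space d → ℝ, ContDiff ℝ ∞ φ → HasCompactSupport φ →
    ∫ x, (fderiv ℝ φ x (EuclideanSpace.single i (1 : ℝ))) • u x = - ∫ x, φ x • g x

/-- A weak partial derivative in `L²` is unique up to null sets. -/
theorem HasWeakPartial.ae_unique {d : ℕ} {i : Fin d} {u g h : Space d → ℂ}
    (hg2 : MemLp g 2) (hh2 : MemLp h 2)
    (hg : HasWeakPartial i u g) (hh : HasWeakPartial i u h) : g =ᵐ[volume] h := by
  have hgl : LocallyIntegrable g volume := hg2.locallyIntegrable (by norm_num)
  have hhl : LocallyIntegrable h volume := hh2.locallyIntegrable (by norm_num)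
  have key : ∀ᵐ x ∂(volume : Measure (Space d)), (g - h) x = 0 := by
    refine ae_eq_zero_of_integral_contDiff_smul_eq_zero (hgl.sub hhl) ?_
    intro φ hφ hc
    have e := (hg φ hφ hc).symm.trans (hh φ hφ hc)
    have ig : Integrable (fun x => φ x • g x) volume :=
      hgl.integrable_smul_left_of_hasCompactSupport hφ.continuous hc
    have ih : Integrable (fun x => φ x • h x) volume :=
      hhl.integrable_smul_left_of_hasCompactSupport hφ.continuous hc
    simp only [Pi.sub_apply, smul_sub]
    rw [integral_sub ig ih, neg_injective e, sub_self]
  filter_upwards [key] with x hx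
  exact sub_eq_zero.mp hx

/-- The energy space `B₁ = {u ∈ H¹(ℝ^d; ℂ) : |y| u ∈ L²}`. Its elements are represented by functions;
every notion below depends only on the almost everywhere class. -/
def MemB1 (d n : ℕ) (u : Space d → ℂ) : Prop :=
  MemLp u 2 ∧
  (∀ i : Fin d, ∃ g : Space d → ℂ, MemLp g 2 ∧ HasWeakPartial i u g) ∧
  MemLp (fun x => (normY d n x : ℂ) * u x) 2

open Classical in
/-- The weak partial derivative `∂_i u ∈ L²`, when it exists (and `0` otherwise). -/
noncomputable def weakPartial {d : ℕ} (i : Fin d) (u : Space d → ℂ) : Space d → ℂ :=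
  if h : ∃ g : Space d → ℂ, MemLp g 2 ∧ HasWeakPartial i u g then h.choose else 0

/-- `‖∇_y u‖²` in `L²`. -/
noncomputable def gradYSq (d n : ℕ) (u : Space d → ℂ) : ℝ :=
  ∑ i : Fin d, if (i : ℕ) < n then ∫ x, ‖weakPartial i u x‖ ^ 2 else 0

/-- `‖∇_z u‖²` in `L²`. -/
noncomputable def gradZSq (d n : ℕ) (u : Space d → ℂ) : ℝ :=
  ∑ i : Fin d, if (i : ℕ) < n then 0 else ∫ x, ‖weakPartial i u x‖ ^ 2

/-- `‖∇_x u‖²` in `L²`. -/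
noncomputable def gradSq (d : ℕ) (u : Space d → ℂ) : ℝ :=
  ∑ i : Fin d, ∫ x, ‖weakPartial i u x‖ ^ 2

/-- `‖y u‖²` in `L²`. -/
noncomputable def momentSq (d n : ℕ) (u : Space d → ℂ) : ℝ :=
  ∫ x, normY d n x ^ 2 * ‖u x‖ ^ 2

/-- `‖u‖²` in `L²`. -/
noncomputable def massSq (d : ℕ) (u : Space d → ℂ) : ℝ :=
  ∫ x, ‖u x‖ ^ 2

/-- The power `2σ+2` of the norm of `u` in `L^(2σ+2)`. -/
noncomputable def potential (d : ℕ) (σ : ℝ) (u : Space d → ℂ) : ℝ :=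
  ∫ x, ‖u x‖ ^ (2 * σ + 2)

/-- The norm of `B₁`. -/
noncomputable def normB1 (d n : ℕ) (u : Space d → ℂ) : ℝ :=
  Real.sqrt (gradSq d u + momentSq d n u + massSq d u)

/-- The action functional `S`. -/
noncomputable def action (d n : ℕ) (σ : ℝ) (u : Space d → ℂ) : ℝ :=
  1 / 2 * gradSq d u + 1 / 2 * momentSq d n u + 1 / 2 * massSq d u
    - 1 / (2 * σ + 2) * potential d σ u

/-- The Nehari functional `I`. -/
noncomputable def nehari (d n : ℕ) (σ : ℝ) (u : Space d → ℂ) : ℝ :=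
  gradSq d u + momentSq d n u + massSq d u - potential d σ u

/-- The virial functional `P`. -/
noncomputable def virial (d n : ℕ) (σ : ℝ) (u : Space d → ℂ) : ℝ :=
  2 / ((d : ℝ) - n) * gradZSq d n u - σ / (σ + 1) * potential d σ u

/-- The scaling `u_t^{a,b}(y, z) = e^{a t} u(y, e^{-b t} z)`. -/
noncomputable def scaling (d n : ℕ) (a b t : ℝ) (u : Space d → ℂ) : Space d → ℂ :=
  fun x => (Real.exp (a * t) : ℂ) *
    u (WithLp.toLp 2 (fun i : Fin d => if (i : ℕ) < n then x i else Real.exp (-b * t) * x i))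

/-- The functional `J^{a,b}(u) = d/dt S(u_t^{a,b})` at `t = 0`. -/
noncomputable def scalingDeriv (d n : ℕ) (σ a b : ℝ) (u : Space d → ℂ) : ℝ :=
  deriv (fun t : ℝ => action d n σ (scaling d n a b t u)) 0

/-- The admissible scaling parameters `(a, b)`. -/
def Admissible (d n : ℕ) (σ a b : ℝ) : Prop :=
  0 < a ∧ b ≤ 0 ∧ 0 ≤ 2 * a + b * ((d : ℝ) - n) ∧ 0 < σ * a + b ∧ (a, b) ≠ ((0 : ℝ), (0 : ℝ))

/-- The set `Γ` of paths `γ ∈ C([0,1]; B₁)` with `γ(0) = 0` and `S(γ(1)) < 0`; continuity is with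
respect to the norm of `B₁`. -/
def paths (d n : ℕ) (σ : ℝ) : Set (unitInterval → Space d → ℂ) :=
  {γ | (∀ s, MemB1 d n (γ s)) ∧
    (∀ s, Filter.Tendsto (fun t => normB1 d n (γ t - γ s)) (nhds s) (nhds 0)) ∧
    γ 0 =ᵐ[volume] 0 ∧ action d n σ (γ 1) < 0}

/-- The mountain pass level `β`: the infimum over `γ ∈ Γ` of `max_{s ∈ [0,1]} S(γ(s))`. -/
noncomputable def mountainPass (d n : ℕ) (σ : ℝ) : ℝ :=
  sInf {m : ℝ | ∃ γ ∈ paths d n σ, IsGreatest (Set.range fun s => action d n σ (γ s)) m}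

/-- `K^{a,b,+} = {u ∈ B₁ : S(u) < β, J^{a,b}(u) ≥ 0}`. -/
def Kplus (d n : ℕ) (σ a b : ℝ) : Set (Space d → ℂ) :=
  {u | MemB1 d n u ∧ action d n σ u < mountainPass d n σ ∧ 0 ≤ scalingDeriv d n σ a b u}

/-- `K^{a,b,-} = {u ∈ B₁ : S(u) < β, J^{a,b}(u) < 0}`. -/
def Kminus (d n : ℕ) (σ a b : ℝ) : Set (Space d → ℂ) :=
  {u | MemB1 d n u ∧ action d n σ u < mountainPass d n σ ∧ scalingDeriv d n σ a b u < 0}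

end PartialNLS

/-! Write `A` for the transverse energy, `B` for half of `‖∇_z u‖²` and `C` for the potential
divided by `2σ+2`. Along the scaling the action is `A e^{pt} + B e^{qt} - C e^{rt}` with `p =
2a+b(d-n)`, `q = p-2b`, `r = (2σ+2)a+b(d-n)`; admissibility gives `0 ≤ p ≤ q < r` and `q > 0`.

The heart is `mountainPass_le_of_scalingDeriv_eq_zero`: if `u ≠ 0` and `J^{a,b}(u) = 0` for one
admissible pair, then `β ≤ S(u)`. Indeed `pA + qB = rC`, and convexity of `exp` makes `t = 0` a
global maximum of the scaled action (`scaled_action_le`). The orbit of `u`, joined to `0` by a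
segment at a very negative time and followed until the action is negative, is a path in `Γ` with
maximum `S(u)`. This needs `B > 0`, from `ae_eq_zero_of_hasWeakPartial_zero`, and continuity of the
orbit in `B₁`, from `tendsto_normB1_rescale`.

Every `J^{a,b}` is a combination of `I` and `P` with nonnegative coefficients
(`scalingDeriv_eq_nehari_virial`), and every nontrivial combination of this kind comes from an
admissible pair. Below `β`, for `u ≠ 0`, none of them vanishes, so `I` and `P` share a strict sign,
which every `J^{a,b}` inherits. For `u = 0` everything vanishes. -/

namespace PartialNLS

/-! ### Partial dilations and change of variables. -/

/-- The dilation factor of the `i`-th coordinate under `(y, z) ↦ (y, δ z)`. -/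
noncomputable def weight {d : ℕ} (n : ℕ) (δ : ℝ) (i : Fin d) : ℝ := if (i : ℕ) < n then 1 else δ

/-- The partial dilation `(y, z) ↦ (y, δ z)`. -/
noncomputable def stretch (d n : ℕ) (δ : ℝ) : Space d →L[ℝ] Space d :=
  LinearMap.toContinuousLinearMap (Matrix.toLpLin 2 2 (Matrix.diagonal (weight n δ)))

theorem stretch_coord {d n : ℕ} (δ : ℝ) (x : Space d) (i : Fin d) :
    stretch d n δ x i = weight n δ i * x i := by
  simp [stretch, Matrix.toLpLin_apply, Matrix.mulVec_diagonal]

theorem stretch_eq_toLp {d n : ℕ} (δ : ℝ) (x : Space d) :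
    WithLp.toLp 2 (fun i : Fin d => if (i : ℕ) < n then x i else δ * x i) = stretch d n δ x := by
  ext i
  rw [stretch_coord]
  by_cases h : (i : ℕ) < n <;> simp [weight, h]

theorem weight_mul {d n : ℕ} (δ ε : ℝ) (i : Fin d) :
    weight n δ i * weight n ε i = weight n (δ * ε) i := by
  by_cases h : (i : ℕ) < n <;> simp [weight, h]

theorem stretch_stretch {d n : ℕ} (δ ε : ℝ) (x : Space d) :
    stretch d n δ (stretch d n ε x) = stretch d n (δ * ε) x := by
  ext i
  rw [stretch_coord, stretch_coord, stretch_coord, ← mul_assoc, weight_mul]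

theorem stretch_one {d n : ℕ} (x : Space d) : stretch d n 1 x = x := by
  ext i
  simp [stretch_coord, weight]

theorem stretch_single {d n : ℕ} (δ : ℝ) (i : Fin d) :
    stretch d n δ (EuclideanSpace.single i 1) = weight n δ i • EuclideanSpace.single i (1 : ℝ) := by
  ext j
  rw [stretch_coord]
  by_cases h : j = i
  · subst h; simp
  · simp [h]

/-- The partial dilation by `δ ≠ 0` as a homeomorphism. -/
noncomputable def stretchHomeo (d n : ℕ) {δ : ℝ} (hδ : δ ≠ 0) : Space d ≃ₜ Space d where
  toFun := stretch d n δ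
  invFun := stretch d n δ⁻¹
  left_inv x := by rw [stretch_stretch, inv_mul_cancel₀ hδ, stretch_one]
  right_inv x := by rw [stretch_stretch, mul_inv_cancel₀ hδ, stretch_one]
  continuous_toFun := (stretch d n δ).continuous
  continuous_invFun := (stretch d n δ⁻¹).continuous

theorem det_stretch {d n : ℕ} (δ : ℝ) (hnd : n < d) :
    LinearMap.det (stretch d n δ : Space d →ₗ[ℝ] Space d) = δ ^ (d - n) := by
  have h : (stretch d n δ : Space d →ₗ[ℝ] Space d) =
      Matrix.toLin (PiLp.basisFun 2 ℝ (Fin d)) (PiLp.basisFun 2 ℝ (Fin d))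
        (Matrix.diagonal (weight n δ)) := by
    rw [← Matrix.toLpLin_eq_toLin]; rfl
  rw [h, LinearMap.det_toLin, Matrix.det_diagonal]
  simp only [weight]
  rw [Finset.prod_ite]
  simp only [Finset.prod_const_one, one_mul, Finset.prod_const, not_lt]
  congr 1
  have : (Finset.univ.filter fun i : Fin d => n ≤ (i : ℕ)) = Finset.Ici (⟨n, hnd⟩ : Fin d) := by
    ext i; simp [Fin.le_def]
  rw [this, Fin.card_Ici]

theorem map_stretch {d n : ℕ} (hnd : n < d) {δ : ℝ} (hδ : 0 < δ) :
    Measure.map (stretch d n δ) (volume : Measure (Space d)) =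
      ENNReal.ofReal (δ ^ (d - n))⁻¹ • volume := by
  have h := Measure.map_linearMap_addHaar_eq_smul_addHaar (volume : Measure (Space d))
    (f := (stretch d n δ : Space d →ₗ[ℝ] Space d)) (by rw [det_stretch δ hnd]; positivity)
  rw [det_stretch δ hnd, abs_of_pos (by positivity)] at h
  exact h

theorem integral_comp_stretch {d n : ℕ} (hnd : n < d) {δ : ℝ} (hδ : 0 < δ)
    {E : Type*} [NormedAddCommGroup E] [NormedSpace ℝ E] (g : Space d → E) :
    ∫ x, g (stretch d n δ x) = (δ ^ (d - n))⁻¹ • ∫ x, g x := by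
  have h := (stretchHomeo d n hδ.ne').measurableEmbedding.integral_map
    (μ := (volume : Measure (Space d))) g
  change ∫ y, g y ∂(Measure.map (stretch d n δ) volume) = ∫ x, g (stretch d n δ x) at h
  rw [← h, map_stretch hnd hδ, integral_smul_measure, ENNReal.toReal_ofReal (by positivity)]

theorem memLp_comp_stretch {d n : ℕ} (hnd : n < d) {δ : ℝ} (hδ : 0 < δ)
    {E : Type*} [NormedAddCommGroup E] {g : Space d → E} {p : ENNReal} (hg : MemLp g p) :
    MemLp (fun x => g (stretch d n δ x)) p := by
  refine ((stretchHomeo d n hδ.ne').measurableEmbedding.memLp_map_measure_iff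
    (μ := (volume : Measure (Space d))) (g := g)).1 ?_
  change MemLp g p (Measure.map (stretch d n δ) volume)
  rw [map_stretch hnd hδ]
  exact hg.smul_measure ENNReal.ofReal_ne_top

/-- Undo the dilation on the test function: both sides acquire the same Jacobian, and the chain rule
contributes the weight of the coordinate. -/
theorem HasWeakPartial.comp_stretch {d n : ℕ} (hnd : n < d) {δ : ℝ} (hδ : 0 < δ) {i : Fin d}
    {u g : Space d → ℂ} (h : HasWeakPartial i u g) :
    HasWeakPartial i (fun x => u (stretch d n δ x))
      (fun x => (weight n δ i : ℂ) * g (stretch d n δ x)) := by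
  intro φ hφ hc
  set ψ : Space d → ℝ := fun x => φ (stretch d n δ⁻¹ x) with hψ
  have hφψ : ∀ x, φ x = ψ (stretch d n δ x) := fun x => by
    simp only [hψ]; rw [stretch_stretch, inv_mul_cancel₀ hδ.ne', stretch_one]
  have hψs : ContDiff ℝ ∞ ψ := hφ.comp (stretch d n δ⁻¹).contDiff
  have hψc : HasCompactSupport ψ :=
    hc.comp_homeomorph (stretchHomeo d n (inv_ne_zero hδ.ne'))
  have hd : ∀ x, fderiv ℝ φ x (EuclideanSpace.single i 1) =
      weight n δ i * fderiv ℝ ψ (stretch d n δ x) (EuclideanSpace.single i 1) := by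
    intro x
    have e : φ = ψ ∘ stretch d n δ := funext hφψ
    rw [e, fderiv_comp x (hψs.differentiable (by simp)).differentiableAt
      (stretch d n δ).differentiableAt]
    simp [stretch_single]
  have e1 : ∫ x, (fderiv ℝ φ x (EuclideanSpace.single i (1 : ℝ))) • u (stretch d n δ x) =
      weight n δ i • ∫ x, (fun y => (fderiv ℝ ψ y (EuclideanSpace.single i (1 : ℝ))) • u y)
        (stretch d n δ x) := by
    rw [← integral_smul]
    congr 1; ext x
    rw [hd]; simp [mul_smul]
  have e2 : ∫ x, φ x • ((weight n δ i : ℂ) * g (stretch d n δ x)) =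
      weight n δ i • ∫ x, (fun y => ψ y • g y) (stretch d n δ x) := by
    rw [← integral_smul]
    congr 1; ext x
    rw [hφψ]; simp; ring
  rw [e1, e2,
    integral_comp_stretch hnd hδ fun y => (fderiv ℝ ψ y (EuclideanSpace.single i (1 : ℝ))) • u y,
    integral_comp_stretch hnd hδ fun y => ψ y • g y, h ψ hψs hψc]
  simp

theorem HasWeakPartial.const_mul {d : ℕ} {i : Fin d} {u g : Space d → ℂ}
    (h : HasWeakPartial i u g) (c : ℂ) :
    HasWeakPartial i (fun x => c * u x) (fun x => c * g x) := by
  intro φ hφ hc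
  have e := h φ hφ hc
  have comm : ∀ (r : ℝ) (w : ℂ), r • (c * w) = c * (r • w) := fun r w => by simp; ring
  simp only [comm]
  rw [integral_const_mul, integral_const_mul, e, mul_neg]

theorem HasWeakPartial.sub {d : ℕ} {i : Fin d} {u v g h : Space d → ℂ}
    (hu2 : MemLp u 2) (hv2 : MemLp v 2) (hg2 : MemLp g 2) (hh2 : MemLp h 2)
    (hu : HasWeakPartial i u g) (hv : HasWeakPartial i v h) :
    HasWeakPartial i (u - v) (g - h) := by
  intro φ hφ hc
  have hd : Continuous fun x => fderiv ℝ φ x (EuclideanSpace.single i (1 : ℝ)) :=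
    (hφ.continuous_fderiv (by simp)).clm_apply continuous_const
  have hdc : HasCompactSupport fun x => fderiv ℝ φ x (EuclideanSpace.single i (1 : ℝ)) :=
    hc.fderiv_apply ℝ _
  have I : ∀ {w : Space d → ℂ} {f : Space d → ℝ}, MemLp w 2 → Continuous f →
      HasCompactSupport f → Integrable (fun x => f x • w x) := fun hw hf hfc =>
    (hw.locallyIntegrable (by norm_num)).integrable_smul_left_of_hasCompactSupport hf hfc
  simp only [Pi.sub_apply, smul_sub]
  rw [integral_sub (I hu2 hd hdc) (I hv2 hd hdc),
    integral_sub (I hg2 hφ.continuous hc) (I hh2 hφ.continuous hc), hu φ hφ hc, hv φ hφ hc]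
  ring

theorem HasWeakPartial.congr_left {d : ℕ} {i : Fin d} {u v g : Space d → ℂ}
    (h : HasWeakPartial i u g) (huv : u =ᵐ[volume] v) : HasWeakPartial i v g := by
  intro φ hφ hc
  rw [← h φ hφ hc]
  refine integral_congr_ae ?_
  filter_upwards [huv] with x hx
  rw [hx]

theorem weakPartial_ae_eq {d : ℕ} {i : Fin d} {u g : Space d → ℂ}
    (hg2 : MemLp g 2) (hg : HasWeakPartial i u g) : weakPartial i u =ᵐ[volume] g := by
  have h : ∃ g : Space d → ℂ, MemLp g 2 ∧ HasWeakPartial i u g := ⟨g, hg2, hg⟩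
  rw [weakPartial, dif_pos h]
  exact HasWeakPartial.ae_unique h.choose_spec.1 hg2 h.choose_spec.2 hg

theorem integral_weakPartial_sq {d : ℕ} {i : Fin d} {u g : Space d → ℂ}
    (hg2 : MemLp g 2) (hg : HasWeakPartial i u g) :
    ∫ x, ‖weakPartial i u x‖ ^ 2 = ∫ x, ‖g x‖ ^ 2 := by
  refine integral_congr_ae ?_
  filter_upwards [weakPartial_ae_eq hg2 hg] with x hx
  rw [hx]

theorem MemB1.weakPartial_spec {d n : ℕ} {u : Space d → ℂ} (hu : MemB1 d n u) (i : Fin d) :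
    MemLp (weakPartial i u) 2 ∧ HasWeakPartial i u (weakPartial i u) := by
  have h := hu.2.1 i
  rw [weakPartial, dif_pos h]
  exact h.choose_spec

/-! ### Effect of rescaling on each term of the energy. -/

/-- The rescaled function `c u(y, δ z)`. -/
noncomputable def rescale (d n : ℕ) (c δ : ℝ) (u : Space d → ℂ) : Space d → ℂ :=
  fun x => (c : ℂ) * u (stretch d n δ x)

theorem scaling_eq_rescale (d n : ℕ) (a b t : ℝ) (u : Space d → ℂ) :
    scaling d n a b t u = rescale d n (Real.exp (a * t)) (Real.exp (-b * t)) u := by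
  ext x
  simp only [scaling, rescale]
  rw [stretch_eq_toLp]

theorem normY_stretch {d n : ℕ} (δ : ℝ) (x : Space d) :
    normY d n (stretch d n δ x) = normY d n x := by
  unfold normY
  congr 1
  refine Finset.sum_congr rfl fun i _ => ?_
  by_cases h : (i : ℕ) < n <;> simp [stretch_coord, weight, h]

theorem hasWeakPartial_rescale {d n : ℕ} (hnd : n < d) {u : Space d → ℂ} (hu : MemB1 d n u)
    (c : ℝ) {δ : ℝ} (hδ : 0 < δ) (i : Fin d) :
    MemLp (rescale d n (c * weight n δ i) δ (weakPartial i u)) 2 ∧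
    HasWeakPartial i (rescale d n c δ u)
      (rescale d n (c * weight n δ i) δ (weakPartial i u)) := by
  obtain ⟨h1, h2⟩ := hu.weakPartial_spec i
  refine ⟨(memLp_comp_stretch hnd hδ h1).const_mul _, ?_⟩
  have h := (h2.comp_stretch hnd hδ).const_mul (c : ℂ)
  have e : (fun x => (c : ℂ) * ((weight n δ i : ℂ) * weakPartial i u (stretch d n δ x))) =
      rescale d n (c * weight n δ i) δ (weakPartial i u) := by
    ext x; simp only [rescale]; push_cast; ring
  rw [e] at h
  exact h

theorem normY_mul_rescale {d n : ℕ} (c δ : ℝ) (u : Space d → ℂ) :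
    (fun x => (normY d n x : ℂ) * rescale d n c δ u x) =
      rescale d n c δ (fun x => (normY d n x : ℂ) * u x) := by
  ext x; simp only [rescale, normY_stretch]; ring

theorem MemB1.rescale {d n : ℕ} (hnd : n < d) {u : Space d → ℂ} (hu : MemB1 d n u)
    (c : ℝ) {δ : ℝ} (hδ : 0 < δ) : MemB1 d n (rescale d n c δ u) := by
  refine ⟨(memLp_comp_stretch hnd hδ hu.1).const_mul _,
    fun i => ⟨_, hasWeakPartial_rescale hnd hu c hδ i⟩, ?_⟩
  rw [normY_mul_rescale]
  exact (memLp_comp_stretch hnd hδ hu.2.2).const_mul _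

theorem integral_norm_rescale_sq {d n : ℕ} (hnd : n < d) (c : ℝ) {δ : ℝ} (hδ : 0 < δ)
    (g : Space d → ℂ) :
    ∫ x, ‖PartialNLS.rescale d n c δ g x‖ ^ 2 = c ^ 2 * (δ ^ (d - n))⁻¹ * ∫ x, ‖g x‖ ^ 2 := by
  simp only [PartialNLS.rescale, norm_mul, mul_pow, Complex.norm_real, Real.norm_eq_abs, sq_abs]
  rw [integral_const_mul, integral_comp_stretch hnd hδ fun x => ‖g x‖ ^ 2, smul_eq_mul, mul_assoc]

theorem gradYSq_rescale {d n : ℕ} (hnd : n < d) {u : Space d → ℂ} (hu : MemB1 d n u)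
    (c : ℝ) {δ : ℝ} (hδ : 0 < δ) :
    gradYSq d n (rescale d n c δ u) = c ^ 2 * (δ ^ (d - n))⁻¹ * gradYSq d n u := by
  unfold gradYSq
  rw [Finset.mul_sum]
  refine Finset.sum_congr rfl fun i _ => ?_
  obtain ⟨h1, h2⟩ := hasWeakPartial_rescale hnd hu c hδ i
  by_cases h : (i : ℕ) < n
  · rw [if_pos h, if_pos h, integral_weakPartial_sq h1 h2, integral_norm_rescale_sq hnd _ hδ]
    simp [weight, h]
  · simp [h]

theorem gradZSq_rescale {d n : ℕ} (hnd : n < d) {u : Space d → ℂ} (hu : MemB1 d n u)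
    (c : ℝ) {δ : ℝ} (hδ : 0 < δ) :
    gradZSq d n (rescale d n c δ u) = c ^ 2 * (δ ^ (d - n))⁻¹ * δ ^ 2 * gradZSq d n u := by
  unfold gradZSq
  rw [Finset.mul_sum]
  refine Finset.sum_congr rfl fun i _ => ?_
  obtain ⟨h1, h2⟩ := hasWeakPartial_rescale hnd hu c hδ i
  by_cases h : (i : ℕ) < n
  · simp [h]
  · rw [if_neg h, if_neg h, integral_weakPartial_sq h1 h2, integral_norm_rescale_sq hnd _ hδ]
    simp only [weight, h, if_false]; ring

theorem gradSq_eq_add (d n : ℕ) (u : Space d → ℂ) : gradSq d u = gradYSq d n u + gradZSq d n u := by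
  unfold gradSq gradYSq gradZSq
  rw [← Finset.sum_add_distrib]
  refine Finset.sum_congr rfl fun i _ => ?_
  by_cases h : (i : ℕ) < n <;> simp [h]

theorem momentSq_eq (d n : ℕ) (u : Space d → ℂ) :
    momentSq d n u = ∫ x, ‖(normY d n x : ℂ) * u x‖ ^ 2 := by
  simp only [momentSq, norm_mul, mul_pow, Complex.norm_real, Real.norm_eq_abs, sq_abs]

theorem momentSq_rescale {d n : ℕ} (hnd : n < d) (u : Space d → ℂ) (c : ℝ) {δ : ℝ} (hδ : 0 < δ) :
    momentSq d n (rescale d n c δ u) = c ^ 2 * (δ ^ (d - n))⁻¹ * momentSq d n u := by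
  rw [momentSq_eq, momentSq_eq, ← integral_norm_rescale_sq hnd c hδ, ← normY_mul_rescale]

theorem massSq_rescale {d n : ℕ} (hnd : n < d) (u : Space d → ℂ) (c : ℝ) {δ : ℝ} (hδ : 0 < δ) :
    massSq d (rescale d n c δ u) = c ^ 2 * (δ ^ (d - n))⁻¹ * massSq d u :=
  integral_norm_rescale_sq hnd c hδ u

theorem potential_rescale {d n : ℕ} (hnd : n < d) (σ : ℝ) (u : Space d → ℂ) (c : ℝ) {δ : ℝ}
    (hδ : 0 < δ) : potential d σ (rescale d n c δ u) =
      |c| ^ (2 * σ + 2) * (δ ^ (d - n))⁻¹ * potential d σ u := by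
  unfold potential
  simp only [rescale, norm_mul, Complex.norm_real, Real.norm_eq_abs]
  simp only [Real.mul_rpow (abs_nonneg _) (norm_nonneg _)]
  rw [integral_const_mul, integral_comp_stretch hnd hδ fun x => ‖u x‖ ^ (2 * σ + 2), smul_eq_mul,
    mul_assoc]

/-! ### Continuity of rescaling in its parameters. -/

theorem continuous_stretch_param {d n : ℕ} (x : Space d) :
    Continuous fun δ : ℝ => stretch d n δ x := by
  simp_rw [← stretch_eq_toLp]
  refine (PiLp.continuous_toLp 2 _).comp (continuous_pi fun i => ?_)
  split_ifs <;> fun_prop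

/-- Confines the supports of all dilates of a test function with `δ ≥ r` to one ball, as dominated
convergence requires. -/
theorem mul_norm_le_norm_stretch {d n : ℕ} {r δ : ℝ} (hr : 0 ≤ r) (hr1 : r ≤ 1) (hrδ : r ≤ δ)
    (x : Space d) : r * ‖x‖ ≤ ‖stretch d n δ x‖ := by
  refine le_of_sq_le_sq ?_ (norm_nonneg _)
  rw [mul_pow, EuclideanSpace.norm_sq_eq, EuclideanSpace.norm_sq_eq, Finset.mul_sum]
  refine Finset.sum_le_sum fun i _ => ?_
  rw [stretch_coord, norm_mul, mul_pow]
  have hw : r ≤ weight n δ i := by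
    unfold weight; split_ifs <;> assumption
  gcongr
  exact hw.trans (le_abs_self _)

theorem integrable_norm_sq {d : ℕ} {f : Space d → ℂ} (hf : MemLp f 2) :
    Integrable fun x => ‖f x‖ ^ 2 := by
  simpa using hf.integrable_norm_rpow (by norm_num) (by norm_num)

theorem memLp_rescale {d n : ℕ} (hnd : n < d) (c : ℝ) {δ : ℝ} (hδ : 0 < δ) {g : Space d → ℂ}
    (hg : MemLp g 2) : MemLp (rescale d n c δ g) 2 :=
  (memLp_comp_stretch hnd hδ hg).const_mul _

/-- Continuity in the parameters of the rescalings of a test function. -/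
theorem tendsto_rescale_of_hasCompactSupport {ι : Type*} {l : Filter ι} [l.IsCountablyGenerated]
    {d n : ℕ} {c δ : ι → ℝ} {c₀ δ₀ : ℝ} (hc : Filter.Tendsto c l (nhds c₀))
    (hδ : Filter.Tendsto δ l (nhds δ₀)) (h₀ : 0 < δ₀)
    {h : Space d → ℂ} (hcont : Continuous h) (hsupp : HasCompactSupport h) :
    Filter.Tendsto (fun t => ∫ x, ‖rescale d n (c t) (δ t) h x - rescale d n c₀ δ₀ h x‖ ^ 2) l
      (nhds 0) := by
  obtain ⟨M, hM⟩ := hsupp.exists_bound_of_continuous hcont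
  obtain ⟨R, hR⟩ := hsupp.isCompact.isBounded.subset_closedBall 0
  -- A lower bound for every dilation factor near the limit: `1` covers the `y` coordinates, `δ₀ /
  -- 2` the `z` coordinates.
  set r : ℝ := min 1 (δ₀ / 2) with hr
  have hr0 : 0 < r := lt_min one_pos (by positivity)
  have hr1 : r ≤ 1 := min_le_left _ _
  have hrδ : r ≤ δ₀ / 2 := min_le_right _ _
  have hM0 : 0 ≤ M := (norm_nonneg _).trans (hM 0)
  have hz : ∀ (e : ℝ) (x : Space d), r ≤ e → x ∉ Metric.closedBall (0 : Space d) (R / r) →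
      h (stretch d n e x) = 0 := by
    intro e x he hx
    refine image_eq_zero_of_notMem_tsupport fun hmem => hx ?_
    have h1 := hR hmem
    rw [mem_closedBall_zero_iff] at h1 ⊢
    rw [le_div_iff₀ hr0, mul_comm]
    exact (mul_norm_le_norm_stretch hr0.le hr1 he x).trans h1
  have hcontx : ∀ (a e : ℝ), Continuous (rescale d n a e h) := fun a e =>
    continuous_const.mul (hcont.comp (stretch d n e).continuous)
  have key := tendsto_integral_filter_of_dominated_convergence
    (μ := (volume : Measure (Space d))) (l := l)
    (F := fun t x => ‖rescale d n (c t) (δ t) h x - rescale d n c₀ δ₀ h x‖ ^ 2)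
    (f := fun _ => 0)
    ((Metric.closedBall (0 : Space d) (R / r)).indicator
      fun _ => ((|c₀| + 1) * M + |c₀| * M) ^ 2)
    (Filter.Eventually.of_forall fun t =>
      (((hcontx _ _).sub (hcontx _ _)).norm.pow 2).aestronglyMeasurable) ?_ ?_ ?_
  · simpa using key
  · have e1 : ∀ᶠ t in l, |c t| ≤ |c₀| + 1 := by
      filter_upwards [hc.abs.eventually (gt_mem_nhds (lt_add_one |c₀|))] with t ht using ht.le
    have e2 : ∀ᶠ t in l, r ≤ δ t := by
      filter_upwards [hδ.eventually (lt_mem_nhds (show r < δ₀ by linarith))] with t ht using ht.le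
    filter_upwards [e1, e2] with t h1 h2
    refine Filter.Eventually.of_forall fun x => ?_
    by_cases hx : x ∈ Metric.closedBall (0 : Space d) (R / r)
    · rw [Set.indicator_of_mem hx, Real.norm_eq_abs, abs_of_nonneg (by positivity)]
      gcongr
      refine (norm_sub_le _ _).trans ?_
      simp only [rescale, norm_mul, Complex.norm_real, Real.norm_eq_abs]
      gcongr <;> exact hM _
    · rw [Set.indicator_of_notMem hx]
      simp only [rescale]
      rw [hz _ x h2 hx, hz δ₀ x (by linarith) hx]
      simp
  · exact (integrable_indicator_iff Metric.isClosed_closedBall.measurableSet).2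
      (integrableOn_const (isCompact_closedBall _ _).measure_lt_top.ne)
  · refine Filter.Eventually.of_forall fun x => ?_
    have h1 : Filter.Tendsto (fun t => rescale d n (c t) (δ t) h x) l
        (nhds (rescale d n c₀ δ₀ h x)) := by
      simp only [rescale]
      refine ((Complex.continuous_ofReal.tendsto _).comp hc).mul ?_
      exact ((hcont.comp (continuous_stretch_param x)).tendsto δ₀).comp hδ
    simpa using ((h1.sub_const (rescale d n c₀ δ₀ h x)).norm.pow 2)

/-- Continuity of `(c, δ) ↦ c g(y, δ z)` in `L²`. -/
theorem tendsto_rescale {ι : Type*} {l : Filter ι} [l.IsCountablyGenerated]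
    {d n : ℕ} (hnd : n < d) {c δ : ι → ℝ} {c₀ δ₀ : ℝ} (hc : Filter.Tendsto c l (nhds c₀))
    (hδ : Filter.Tendsto δ l (nhds δ₀)) (h₀ : 0 < δ₀) {g : Space d → ℂ} (hg : MemLp g 2) :
    Filter.Tendsto (fun t => ∫ x, ‖rescale d n (c t) (δ t) g x - rescale d n c₀ δ₀ g x‖ ^ 2) l
      (nhds 0) := by
  set K : ℝ := c₀ ^ 2 * (δ₀ ^ (d - n))⁻¹ + 1 with hK
  have hKpos : 0 < K := by positivity
  have hlim : Filter.Tendsto (fun t => c t ^ 2 * (δ t ^ (d - n))⁻¹) l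
      (nhds (c₀ ^ 2 * (δ₀ ^ (d - n))⁻¹)) :=
    (hc.pow 2).mul ((hδ.pow (d - n)).inv₀ (by positivity))
  have hKe : ∀ᶠ t in l, c t ^ 2 * (δ t ^ (d - n))⁻¹ ≤ K := by
    filter_upwards [hlim.eventually (gt_mem_nhds (lt_add_one _))] with t ht using ht.le
  have hpos : ∀ᶠ t in l, 0 < δ t := hδ.eventually (lt_mem_nhds h₀)
  rw [Metric.tendsto_nhds]
  intro ε hε
  obtain ⟨h, hsupp, hclose, hcont, hmem⟩ :=
    MemLp.exists_hasCompactSupport_integral_rpow_sub_le (p := 2) (by norm_num)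
      (f := g) (μ := (volume : Measure (Space d))) (by simpa using hg)
      -- `K` bounds the factor by which the rescalings multiply squared `L²` norms, so each
      -- approximation error is at most `ε/12`. With `(p+q+s)² ≤ 3(p²+q²+s²)` the total is below
      -- `3(ε/12 + ε/6 + ε/12) = ε`.
      (ε := ε / (12 * K)) (by positivity)
  have hh : MemLp h 2 := by simpa using hmem
  have hclose' : ∫ x, ‖(g - h) x‖ ^ 2 ≤ ε / (12 * K) := by simpa using hclose
  have hsub : ∀ (a e : ℝ) (x : Space d),
      rescale d n a e (g - h) x = rescale d n a e g x - rescale d n a e h x := by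
    intro a e x; simp only [rescale, Pi.sub_apply]; ring
  have hmid := tendsto_rescale_of_hasCompactSupport (n := n) hc hδ h₀ hcont hsupp
  filter_upwards [hKe, hpos, hmid.eventually (gt_mem_nhds (show 0 < ε / 6 by positivity))]
    with t hKt hδt hmidt
  have hbound : ∀ (a e : ℝ), 0 < e → a ^ 2 * (e ^ (d - n))⁻¹ ≤ K →
      ∫ x, ‖rescale d n a e (g - h) x‖ ^ 2 ≤ ε / 12 := by
    intro a e he hae
    rw [integral_norm_rescale_sq hnd a he]
    calc _ ≤ K * (ε / (12 * K)) := by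
          gcongr
      _ = ε / 12 := by field_simp
  have I1 := integrable_norm_sq (memLp_rescale hnd (c t) hδt (hg.sub hh))
  have I2 := integrable_norm_sq
    ((memLp_rescale hnd (c t) hδt hh).sub (memLp_rescale hnd c₀ h₀ hh))
  have I3 := integrable_norm_sq (memLp_rescale hnd c₀ h₀ (hg.sub hh))
  simp only [Pi.sub_apply] at I2
  have I12 : Integrable fun x => ‖rescale d n (c t) (δ t) (g - h) x‖ ^ 2 +
      ‖rescale d n (c t) (δ t) h x - rescale d n c₀ δ₀ h x‖ ^ 2 := I1.add I2
  have hle : ∫ x, ‖rescale d n (c t) (δ t) g x - rescale d n c₀ δ₀ g x‖ ^ 2 ≤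
      ∫ x, 3 * (‖rescale d n (c t) (δ t) (g - h) x‖ ^ 2 +
        ‖rescale d n (c t) (δ t) h x - rescale d n c₀ δ₀ h x‖ ^ 2 +
        ‖rescale d n c₀ δ₀ (g - h) x‖ ^ 2) := by
    refine integral_mono_of_nonneg (Filter.Eventually.of_forall fun x => by positivity)
      ((I12.add I3).const_mul 3) (Filter.Eventually.of_forall fun x => ?_)
    have e : rescale d n (c t) (δ t) g x - rescale d n c₀ δ₀ g x =
        rescale d n (c t) (δ t) (g - h) x +
        (rescale d n (c t) (δ t) h x - rescale d n c₀ δ₀ h x) -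
        rescale d n c₀ δ₀ (g - h) x := by
      rw [hsub, hsub]; ring
    have tri : ‖rescale d n (c t) (δ t) g x - rescale d n c₀ δ₀ g x‖ ≤
        ‖rescale d n (c t) (δ t) (g - h) x‖ +
        ‖rescale d n (c t) (δ t) h x - rescale d n c₀ δ₀ h x‖ +
        ‖rescale d n c₀ δ₀ (g - h) x‖ := by
      rw [e]
      exact (norm_sub_le _ _).trans (add_le_add_left (norm_add_le _ _) _)
    refine (pow_le_pow_left₀ (norm_nonneg _) tri 2).trans ?_
    beta_reduce
    generalize ‖rescale d n (c t) (δ t) (g - h) x‖ = p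
    generalize ‖rescale d n (c t) (δ t) h x - rescale d n c₀ δ₀ h x‖ = q
    generalize ‖rescale d n c₀ δ₀ (g - h) x‖ = s
    nlinarith [sq_nonneg (p - q), sq_nonneg (q - s), sq_nonneg (p - s)]
  rw [integral_const_mul, integral_add I12 I3, integral_add I1 I2] at hle
  have b1 := hbound (c t) (δ t) hδt hKt
  have b3 := hbound c₀ δ₀ h₀ (by rw [hK]; linarith)
  rw [Real.dist_eq, sub_zero, abs_of_nonneg (integral_nonneg fun x => by positivity)]
  linarith

/-- Each term becomes a squared `L²` distance between two rescalings of one fixed function, so `L²`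
continuity applies term by term. -/
theorem normB1_rescale_sub {d n : ℕ} (hnd : n < d) {u : Space d → ℂ} (hu : MemB1 d n u)
    (c c₀ : ℝ) {δ δ₀ : ℝ} (hδ : 0 < δ) (h₀ : 0 < δ₀) :
    normB1 d n (rescale d n c δ u - rescale d n c₀ δ₀ u) = Real.sqrt (
      (∑ i, ∫ x, ‖rescale d n (c * weight n δ i) δ (weakPartial i u) x -
        rescale d n (c₀ * weight n δ₀ i) δ₀ (weakPartial i u) x‖ ^ 2) +
      (∫ x, ‖rescale d n c δ (fun x => (normY d n x : ℂ) * u x) x -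
        rescale d n c₀ δ₀ (fun x => (normY d n x : ℂ) * u x) x‖ ^ 2) +
      ∫ x, ‖rescale d n c δ u x - rescale d n c₀ δ₀ u x‖ ^ 2) := by
  unfold normB1
  congr 2
  congr 1
  · unfold gradSq
    refine Finset.sum_congr rfl fun i _ => ?_
    obtain ⟨h1, h2⟩ := hasWeakPartial_rescale hnd hu c hδ i
    obtain ⟨h3, h4⟩ := hasWeakPartial_rescale hnd hu c₀ h₀ i
    exact integral_weakPartial_sq (h1.sub h3)
      (HasWeakPartial.sub (memLp_rescale hnd c hδ hu.1) (memLp_rescale hnd c₀ h₀ hu.1) h1 h3 h2 h4)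
  · rw [momentSq_eq]
    simp only [← normY_mul_rescale, Pi.sub_apply, mul_sub]

/-- Continuity of `(c, δ) ↦ c u(y, δ z)` in `B₁`. -/
theorem tendsto_normB1_rescale {ι : Type*} {l : Filter ι} [l.IsCountablyGenerated]
    {d n : ℕ} (hnd : n < d) {c δ : ι → ℝ} {c₀ δ₀ : ℝ} (hc : Filter.Tendsto c l (nhds c₀))
    (hδ : Filter.Tendsto δ l (nhds δ₀)) (h₀ : 0 < δ₀) {u : Space d → ℂ} (hu : MemB1 d n u) :
    Filter.Tendsto (fun t => normB1 d n (rescale d n (c t) (δ t) u - rescale d n c₀ δ₀ u)) l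
      (nhds 0) := by
  have hpos : ∀ᶠ t in l, 0 < δ t := hδ.eventually (lt_mem_nhds h₀)
  have hw : ∀ i : Fin d, Filter.Tendsto (fun t => c t * weight n (δ t) i) l
      (nhds (c₀ * weight n δ₀ i)) := by
    intro i
    refine hc.mul ?_
    unfold weight
    split_ifs
    · exact tendsto_const_nhds
    · exact hδ
  have h := (((tendsto_finsetSum Finset.univ fun i _ =>
    tendsto_rescale hnd (hw i) hδ h₀ (hu.weakPartial_spec i).1).add
    (tendsto_rescale hnd hc hδ h₀ hu.2.2)).add (tendsto_rescale hnd hc hδ h₀ hu.1)).sqrt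
  simp only [Finset.sum_const_zero, add_zero, Real.sqrt_zero] at h
  refine h.congr' ?_
  filter_upwards [hpos] with t ht
  rw [normB1_rescale_sub hnd hu (c t) c₀ ht h₀]

/-! ### Vanishing of `L²` functions with a zero partial derivative. -/

/-- The mean of `u` against translates of a test function vanishes at infinity. -/
theorem integral_translate_small {d : ℕ} {u : Space d → ℂ} (hu : MemLp u 2) {φ : Space d → ℝ}
    (hφ : Continuous φ) (hc : HasCompactSupport φ) {e : Space d} (he : ‖e‖ = 1) {ε : ℝ}
    (hε : 0 < ε) : ∃ s : ℝ, ‖∫ t, φ (s • e - t) • u t‖ < ε := by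
  set C : ℝ := ∫ t, φ t ^ 2 with hC
  have hC0 : 0 ≤ C := integral_nonneg fun t => by positivity
  -- Weight in Young's inequality `pq ≤ η p²/2 + q²/(2η)`; the test function then contributes at
  -- most `ηC/2 < ε/2`.
  set η : ℝ := ε / (C + 1) with hη
  have hη0 : 0 < η := by positivity
  have hηC : η * C < ε := by
    rw [hη, div_mul_eq_mul_div, div_lt_iff₀ (by positivity)]
    nlinarith
  obtain ⟨R, hR⟩ := hc.isCompact.isBounded.subset_closedBall 0
  have hmeas : ∀ x : Space d, MeasurableSet {t : Space d | x - t ∈ tsupport φ} := fun x =>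
    (isClosed_tsupport φ).measurableSet.preimage (by fun_prop)
  -- The mass of `u` on the moving support tends to zero: each fixed point is eventually left
  -- behind, and `‖u‖²` dominates.
  have hlim := tendsto_integral_filter_of_dominated_convergence
    (μ := (volume : Measure (Space d))) (l := Filter.atTop)
    (F := fun (s : ℝ) t => {t : Space d | s • e - t ∈ tsupport φ}.indicator
      (fun t => ‖u t‖ ^ 2) t) (f := fun _ => 0) (fun t => ‖u t‖ ^ 2)
    (Filter.Eventually.of_forall fun s =>
      (integrable_norm_sq hu).aestronglyMeasurable.indicator (hmeas _))
    (Filter.Eventually.of_forall fun s => Filter.Eventually.of_forall fun t => by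
      refine (norm_indicator_le_norm_self _ _).trans ?_
      simp)
    (integrable_norm_sq hu)
    (Filter.Eventually.of_forall fun t => by
      refine tendsto_const_nhds.congr' ?_
      filter_upwards [Filter.eventually_gt_atTop (max 0 (R + ‖t‖))] with s hs
      rw [Set.indicator_of_notMem]
      intro hmem
      have h1 := hR hmem
      rw [mem_closedBall_zero_iff] at h1
      have h2 : ‖s • e‖ - ‖t‖ ≤ ‖s • e - t‖ := norm_sub_norm_le _ _
      rw [norm_smul, he, mul_one, Real.norm_eq_abs] at h2
      have h3 := le_abs_self s
      have h4 := (le_max_right 0 (R + ‖t‖)).trans_lt hs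
      linarith)
  rw [integral_zero] at hlim
  obtain ⟨s, hs⟩ := (hlim.eventually (gt_mem_nhds (show 0 < η * ε by positivity))).exists
  refine ⟨s, ?_⟩
  have J1 : Integrable fun t => η / 2 * φ (s • e - t) ^ 2 := by
    have hs : HasCompactSupport fun t => φ (s • e - t) :=
      hc.comp_homeomorph (Homeomorph.subLeft (s • e))
    have hs2 : HasCompactSupport fun t => η / 2 * φ (s • e - t) ^ 2 :=
      hs.comp_left (g := fun r : ℝ => η / 2 * r ^ 2) (by simp)
    exact Continuous.integrable_of_hasCompactSupport (by fun_prop) hs2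
  have J2 : Integrable fun t => 1 / (2 * η) * {t : Space d | s • e - t ∈ tsupport φ}.indicator
      (fun t => ‖u t‖ ^ 2) t :=
    ((integrable_norm_sq hu).indicator (hmeas _)).const_mul _
  have hle : ‖∫ t, φ (s • e - t) • u t‖ ≤ ∫ t, (η / 2 * φ (s • e - t) ^ 2 +
      1 / (2 * η) * {t : Space d | s • e - t ∈ tsupport φ}.indicator (fun t => ‖u t‖ ^ 2) t) := by
    refine norm_integral_le_of_norm_le (J1.add J2) (Filter.Eventually.of_forall fun t => ?_)
    by_cases ht : s • e - t ∈ tsupport φ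
    · rw [Set.indicator_of_mem (by exact ht), norm_smul, Real.norm_eq_abs, ← sq_abs (φ _)]
      generalize |φ (s • e - t)| = p
      generalize ‖u t‖ = q
      have : η / 2 * p ^ 2 + 1 / (2 * η) * q ^ 2 - p * q = (η * p - q) ^ 2 / (2 * η) := by
        field_simp; ring
      have h2 : 0 ≤ (η * p - q) ^ 2 / (2 * η) := by positivity
      linarith
    · rw [Set.indicator_of_notMem (by exact ht), image_eq_zero_of_notMem_tsupport ht]
      simp
  rw [integral_add J1 J2, integral_const_mul, integral_const_mul,
    integral_sub_left_eq_self (fun t => φ t ^ 2) volume (s • e), ← hC] at hle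
  have h2 : 1 / (2 * η) * ∫ t, {t : Space d | s • e - t ∈ tsupport φ}.indicator
      (fun t => ‖u t‖ ^ 2) t < ε / 2 := by
    calc _ < 1 / (2 * η) * (η * ε) := by gcongr
      _ = ε / 2 := by field_simp
  linarith

/-- A square integrable function with a vanishing weak partial derivative is zero. -/
theorem ae_eq_zero_of_hasWeakPartial_zero {d : ℕ} {i : Fin d} {u g : Space d → ℂ}
    (hu : MemLp u 2) (h : HasWeakPartial i u g) (hg : g =ᵐ[volume] 0) : u =ᵐ[volume] 0 := by
  have hul : LocallyIntegrable u volume := hu.locallyIntegrable (by norm_num)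
  refine ae_eq_zero_of_integral_contDiff_smul_eq_zero hul fun ψ hψ hψc => ?_
  set e : Space d := EuclideanSpace.single i 1 with he
  -- The reflection makes the mollification `F` satisfy `F 0 = ∫ ψ u`. `F` is constant along `e` and
  -- small far out on that line, so this integral is zero.
  set φ : Space d → ℝ := fun x => ψ (-x) with hφdef
  have hφ : ContDiff ℝ ∞ φ := hψ.comp contDiff_neg
  have hc : HasCompactSupport φ := hψc.comp_homeomorph (Homeomorph.neg (Space d))
  set L : ℂ →L[ℝ] ℝ →L[ℝ] ℂ := (ContinuousLinearMap.lsmul ℝ ℝ).flip with hL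
  set F : Space d → ℂ := fun x => ∫ t, φ (x - t) • u t with hF
  have hFc : F = convolution u φ L volume := by
    ext x; simp [hF, convolution, hL]
  have hder : ∀ x, HasFDerivAt F (convolution u (fderiv ℝ φ)
      (ContinuousLinearMap.precompR (Space d) L) volume x) x := by
    intro x
    rw [hFc]
    exact hc.hasFDerivAt_convolution_right L hul (hφ.of_le (by simp)) x
  -- Up to sign, the derivative of `F` along `e` is the weak derivative of `u` tested against `t ↦ φ
  -- (x - t)`.
  have hzero : ∀ x, (convolution u (fderiv ℝ φ)
      (ContinuousLinearMap.precompR (Space d) L) volume x) e = 0 := by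
    intro x
    rw [convolution_precompR_apply L hul (hc.fderiv ℝ) (hφ.continuous_fderiv (by simp))]
    have hχ : ContDiff ℝ ∞ fun t => φ (x - t) := hφ.comp (contDiff_const.sub contDiff_id)
    have hχc : HasCompactSupport fun t => φ (x - t) :=
      hc.comp_homeomorph (Homeomorph.subLeft x)
    have key := h _ hχ hχc
    have hr : ∫ t, φ (x - t) • g t = 0 := by
      rw [← integral_zero (Space d) ℂ]
      refine integral_congr_ae ?_
      filter_upwards [hg] with t ht
      rw [ht]; simp
    rw [hr, neg_zero] at key
    have hd : ∀ t, fderiv ℝ (fun t => φ (x - t)) t e = -(fderiv ℝ φ (x - t) e) := by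
      intro t
      have h1 : HasFDerivAt φ (fderiv ℝ φ (x - t)) (x - t) :=
        (hφ.differentiable (by simp)).differentiableAt.hasFDerivAt
      have h2 : HasFDerivAt (fun t : Space d => x - t) (-ContinuousLinearMap.id ℝ (Space d)) t :=
        (hasFDerivAt_id t).const_sub x
      have h3 : HasFDerivAt (fun t => φ (x - t)) _ t := h1.comp t h2
      rw [h3.fderiv]
      simp
    simp only [← he, hd, neg_smul, integral_neg, neg_eq_zero] at key
    simpa [convolution, hL] using key
  have hconst : ∀ s : ℝ, F (s • e) = F 0 := by
    intro s
    have hline : ∀ r : ℝ, HasDerivAt (fun r : ℝ => F (r • e)) 0 r := by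
      intro r
      have h1 : HasDerivAt (fun r : ℝ => r • e) ((1 : ℝ) • e) r := (hasDerivAt_id r).smul_const e
      have h2 := (hder (r • e)).comp_hasDerivAt r h1
      rw [one_smul, hzero] at h2
      exact h2
    have := is_const_of_deriv_eq_zero (fun r => (hline r).differentiableAt)
      (fun r => (hline r).deriv) s 0
    simpa using this
  have hF0 : F 0 = ∫ x, ψ x • u x := by simp [hF, hφdef]
  rw [← hF0, ← norm_le_zero_iff]
  refine le_of_forall_pos_le_add fun ε hε => ?_
  obtain ⟨s, hs⟩ := integral_translate_small hu hφ.continuous hc (e := e) (by simp [he]) hε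
  change ‖F (s • e)‖ < ε at hs
  rw [hconst] at hs
  linarith

/-! ### The action along the scalings. -/

/-- The part of the quadratic energy that scales like the mass under `z ↦ δ z`. -/
noncomputable def transverseEnergy (d n : ℕ) (u : Space d → ℂ) : ℝ :=
  1 / 2 * (gradYSq d n u + momentSq d n u + massSq d u)

theorem transverseEnergy_nonneg (d n : ℕ) (u : Space d → ℂ) : 0 ≤ transverseEnergy d n u := by
  have h1 : 0 ≤ gradYSq d n u := Finset.sum_nonneg fun i _ => by
    split_ifs
    · exact integral_nonneg fun x => by positivity
    · exact le_rfl
  have h2 : 0 ≤ momentSq d n u := integral_nonneg fun x => by positivity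
  have h3 : 0 ≤ massSq d u := integral_nonneg fun x => by positivity
  unfold transverseEnergy
  positivity

theorem gradZSq_nonneg (d n : ℕ) (u : Space d → ℂ) : 0 ≤ gradZSq d n u :=
  Finset.sum_nonneg fun i _ => by
    split_ifs
    · exact le_rfl
    · exact integral_nonneg fun x => by positivity

theorem potential_nonneg (d : ℕ) (σ : ℝ) (u : Space d → ℂ) : 0 ≤ potential d σ u :=
  integral_nonneg fun x => by positivity

theorem action_eq (d n : ℕ) (σ : ℝ) (u : Space d → ℂ) :
    action d n σ u = transverseEnergy d n u + 1 / 2 * gradZSq d n u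
      - 1 / (2 * σ + 2) * potential d σ u := by
  rw [action, transverseEnergy, gradSq_eq_add d n]
  ring

/-- The extra amplitude `θ` serves the segment from `0` to the orbit; `θ = 1` gives the orbit
itself. -/
theorem action_rescale_exp {d n : ℕ} (hnd : n < d) {σ : ℝ} {u : Space d → ℂ} (hu : MemB1 d n u)
    (a b t : ℝ) {θ : ℝ} (hθ : 0 ≤ θ) :
    action d n σ (rescale d n (θ * Real.exp (a * t)) (Real.exp (-b * t)) u) =
      θ ^ 2 * (transverseEnergy d n u * Real.exp ((2 * a + b * ((d : ℝ) - n)) * t) +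
        1 / 2 * gradZSq d n u * Real.exp ((2 * a + b * ((d : ℝ) - n) - 2 * b) * t)) -
      θ ^ (2 * σ + 2) * (1 / (2 * σ + 2) * potential d σ u *
        Real.exp (((2 * σ + 2) * a + b * ((d : ℝ) - n)) * t)) := by
  have hδ : 0 < Real.exp (-b * t) := Real.exp_pos _
  rw [action_eq, transverseEnergy, gradYSq_rescale hnd hu _ hδ, gradZSq_rescale hnd hu _ hδ,
    momentSq_rescale hnd _ _ hδ, massSq_rescale hnd _ _ hδ, potential_rescale hnd _ _ _ hδ,
    transverseEnergy, abs_of_nonneg (mul_nonneg hθ (Real.exp_pos _).le),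
    Real.mul_rpow hθ (Real.exp_pos _).le, ← Real.exp_mul, ← Real.exp_nat_mul, ← Real.exp_neg,
    ← Real.exp_nat_mul, mul_pow, ← Real.exp_nat_mul, Nat.cast_sub hnd.le]
  have e1 : Real.exp ((2 * a + b * ((d : ℝ) - n)) * t) =
      Real.exp ((2 : ℕ) * (a * t)) * Real.exp (-(((d : ℝ) - n) * (-b * t))) := by
    rw [← Real.exp_add]; congr 1; push_cast; ring
  have e2 : Real.exp ((2 * a + b * ((d : ℝ) - n) - 2 * b) * t) =
      Real.exp ((2 : ℕ) * (a * t)) * Real.exp (-(((d : ℝ) - n) * (-b * t))) *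
        Real.exp ((2 : ℕ) * (-b * t)) := by
    rw [← Real.exp_add, ← Real.exp_add]; congr 1; push_cast; ring
  have e3 : Real.exp (((2 * σ + 2) * a + b * ((d : ℝ) - n)) * t) =
      Real.exp (a * t * (2 * σ + 2)) * Real.exp (-(((d : ℝ) - n) * (-b * t))) := by
    rw [← Real.exp_add]; congr 1; ring
  rw [e1, e2, e3]
  ring

theorem action_scaling {d n : ℕ} (hnd : n < d) {σ : ℝ} {u : Space d → ℂ} (hu : MemB1 d n u)
    (a b t : ℝ) :
    action d n σ (scaling d n a b t u) =
      transverseEnergy d n u * Real.exp ((2 * a + b * ((d : ℝ) - n)) * t) +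
      1 / 2 * gradZSq d n u * Real.exp ((2 * a + b * ((d : ℝ) - n) - 2 * b) * t) -
      1 / (2 * σ + 2) * potential d σ u *
        Real.exp (((2 * σ + 2) * a + b * ((d : ℝ) - n)) * t) := by
  have h := action_rescale_exp hnd (σ := σ) hu a b t (θ := 1) zero_le_one
  rw [one_mul, Real.one_rpow] at h
  rw [scaling_eq_rescale, h]
  ring

theorem scalingDeriv_eq {d n : ℕ} (hnd : n < d) {σ : ℝ} {u : Space d → ℂ} (hu : MemB1 d n u)
    (a b : ℝ) :
    scalingDeriv d n σ a b u =
      (2 * a + b * ((d : ℝ) - n)) * transverseEnergy d n u +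
      (2 * a + b * ((d : ℝ) - n) - 2 * b) * (1 / 2 * gradZSq d n u) -
      ((2 * σ + 2) * a + b * ((d : ℝ) - n)) * (1 / (2 * σ + 2) * potential d σ u) := by
  unfold scalingDeriv
  simp_rw [action_scaling hnd hu]
  have he : ∀ p : ℝ, HasDerivAt (fun t : ℝ => Real.exp (p * t)) p 0 := by
    intro p
    have h := ((hasDerivAt_id (0 : ℝ)).const_mul p).exp
    simpa using h
  have h := (((he (2 * a + b * ((d : ℝ) - n))).const_mul (transverseEnergy d n u)).add
    ((he (2 * a + b * ((d : ℝ) - n) - 2 * b)).const_mul (1 / 2 * gradZSq d n u))).sub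
    ((he ((2 * σ + 2) * a + b * ((d : ℝ) - n))).const_mul (1 / (2 * σ + 2) * potential d σ u))
  refine h.deriv.trans ?_
  ring

theorem hasWeakPartial_zero_of_ae_eq_zero {d : ℕ} (i : Fin d) {u : Space d → ℂ}
    (hu : u =ᵐ[volume] 0) : HasWeakPartial i u 0 := by
  have h0 : HasWeakPartial i (0 : Space d → ℂ) 0 := fun φ _ _ => by simp
  exact h0.congr_left hu.symm

theorem gradYSq_of_ae_eq_zero {d n : ℕ} {u : Space d → ℂ} (hu : u =ᵐ[volume] 0) :
    gradYSq d n u = 0 :=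
  Finset.sum_eq_zero fun i _ => by
    rw [integral_weakPartial_sq MemLp.zero (hasWeakPartial_zero_of_ae_eq_zero i hu)]
    simp

theorem gradZSq_of_ae_eq_zero {d n : ℕ} {u : Space d → ℂ} (hu : u =ᵐ[volume] 0) :
    gradZSq d n u = 0 :=
  Finset.sum_eq_zero fun i _ => by
    rw [integral_weakPartial_sq MemLp.zero (hasWeakPartial_zero_of_ae_eq_zero i hu)]
    simp

theorem transverseEnergy_of_ae_eq_zero {d n : ℕ} {u : Space d → ℂ} (hu : u =ᵐ[volume] 0) :
    transverseEnergy d n u = 0 := by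
  have h1 : momentSq d n u = 0 := by
    unfold momentSq
    rw [← integral_zero (Space d) ℝ]
    refine integral_congr_ae ?_
    filter_upwards [hu] with x hx
    simp [hx]
  have h2 : massSq d u = 0 := by
    unfold massSq
    rw [← integral_zero (Space d) ℝ]
    refine integral_congr_ae ?_
    filter_upwards [hu] with x hx
    simp [hx]
  rw [transverseEnergy, gradYSq_of_ae_eq_zero hu, h1, h2]
  norm_num

theorem potential_of_ae_eq_zero {d : ℕ} {σ : ℝ} (hσ : 0 < σ) {u : Space d → ℂ}
    (hu : u =ᵐ[volume] 0) : potential d σ u = 0 := by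
  unfold potential
  rw [← integral_zero (Space d) ℝ]
  refine integral_congr_ae ?_
  filter_upwards [hu] with x hx
  rw [hx, Pi.zero_apply, norm_zero, Real.zero_rpow (by positivity)]

theorem ae_eq_zero_of_gradZSq_eq_zero {d n : ℕ} (hnd : n < d) {u : Space d → ℂ}
    (hu : MemB1 d n u) (h : gradZSq d n u = 0) : u =ᵐ[volume] 0 := by
  -- Coordinate `n`, counted from zero, is the first `z` coordinate; one vanishing derivative
  -- suffices.
  obtain ⟨h1, h2⟩ := hu.weakPartial_spec ⟨n, hnd⟩
  refine ae_eq_zero_of_hasWeakPartial_zero hu.1 h2 ?_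
  have hz := (Finset.sum_eq_zero_iff_of_nonneg (fun i _ => by
    split_ifs
    · exact le_rfl
    · exact integral_nonneg fun x => by positivity)).1 h ⟨n, hnd⟩ (Finset.mem_univ _)
  simp only [lt_irrefl, if_false] at hz
  rw [integral_eq_zero_iff_of_nonneg (fun x => by positivity) (integrable_norm_sq h1)] at hz
  filter_upwards [hz] with x hx
  simpa using hx

/-! ### Inequalities for sums of exponentials. -/

theorem exp_mul_sub_one_le {p r : ℝ} (hp : 0 ≤ p) (hpr : p ≤ r) (hr : 0 < r) (t : ℝ) :
    Real.exp (p * t) - 1 ≤ p / r * (Real.exp (r * t) - 1) := by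
  -- Convexity between `0` and `r t`, with weight `p / r` on the latter.
  have h := convexOn_exp.2 (Set.mem_univ (0 : ℝ)) (Set.mem_univ (r * t))
    (show 0 ≤ 1 - p / r by rw [sub_nonneg, div_le_one hr]; exact hpr)
    (show 0 ≤ p / r by positivity) (by ring)
  have e : (1 - p / r) • (0 : ℝ) + (p / r) • (r * t) = p * t := by
    simp only [smul_eq_mul]; field_simp; ring
  rw [e, Real.exp_zero] at h
  simp only [smul_eq_mul] at h
  linarith

/-- A critical point at `0` of the scaled action is a global maximum. -/
theorem scaled_action_le {A B C p q r : ℝ} (hA : 0 ≤ A) (hB : 0 ≤ B) (hp : 0 ≤ p) (hpr : p ≤ r)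
    (hq : 0 ≤ q) (hqr : q ≤ r) (hr : 0 < r) (h : p * A + q * B = r * C) (t : ℝ) :
    A * Real.exp (p * t) + B * Real.exp (q * t) - C * Real.exp (r * t) ≤ A + B - C := by
  have h1 := mul_le_mul_of_nonneg_left (exp_mul_sub_one_le hp hpr hr t) hA
  have h2 := mul_le_mul_of_nonneg_left (exp_mul_sub_one_le hq hqr hr t) hB
  have h3 : A * (p / r * (Real.exp (r * t) - 1)) + B * (q / r * (Real.exp (r * t) - 1)) =
      C * (Real.exp (r * t) - 1) := by
    have : C = (p * A + q * B) / r := by rw [h]; field_simp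
    rw [this]; field_simp
  linarith

/-- The threshold is chosen so that, under `pA + qB = rC`, the quadratic energy at such times is at
most `A + B - C`. When `p = 0` there is no decay, but both sides equal `1`. -/
theorem eventually_exp_le {p r : ℝ} (hp : 0 ≤ p) (hpr : p < r) :
    ∀ᶠ t in Filter.atBot, Real.exp (p * t) ≤ 1 - p / r := by
  rcases hp.eq_or_lt with rfl | hp
  · simp
  · have h : Filter.Tendsto (fun t : ℝ => Real.exp (p * t)) Filter.atBot (nhds 0) :=
      Real.tendsto_exp_atBot.comp (Filter.tendsto_id.const_mul_atBot hp)
    have h1 : 0 < 1 - p / r := by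
      rw [sub_pos, div_lt_one (hp.trans hpr)]; exact hpr
    filter_upwards [h.eventually (gt_mem_nhds h1)] with t ht using ht.le

/-- The potential has the largest exponent and wins at infinity. -/
theorem eventually_scaled_action_neg {A B C p q r : ℝ} (hC : 0 < C) (hpr : p < r) (hqr : q < r) :
    ∀ᶠ t in Filter.atTop,
      A * Real.exp (p * t) + B * Real.exp (q * t) - C * Real.exp (r * t) < 0 := by
  have h : ∀ {s : ℝ}, s < r →
      Filter.Tendsto (fun t : ℝ => Real.exp ((s - r) * t)) Filter.atTop (nhds 0) := fun hs =>
    Real.tendsto_exp_atBot.comp (Filter.tendsto_id.const_mul_atTop_of_neg (sub_neg.2 hs))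
  have h2 := ((h hpr).const_mul A).add ((h hqr).const_mul B)
  rw [mul_zero, mul_zero, add_zero] at h2
  filter_upwards [h2.eventually (gt_mem_nhds hC)] with t ht
  have e : ∀ s : ℝ, Real.exp (s * t) = Real.exp ((s - r) * t) * Real.exp (r * t) := fun s => by
    rw [← Real.exp_add]; congr 1; ring
  rw [e p, e q]
  have := mul_lt_mul_of_pos_right ht (Real.exp_pos (r * t))
  linarith

/-! ### Paths through critical points of the scaling. -/

theorem mountainPass_le_of_mem_paths {d n : ℕ} {σ : ℝ} (hσ : 0 < σ) {γ : unitInterval → Space d → ℂ}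
    (hγ : γ ∈ paths d n σ) {m : ℝ} (hm : IsGreatest (Set.range fun s => action d n σ (γ s)) m) :
    mountainPass d n σ ≤ m := by
  -- Zero is a lower bound: every path starts at `0`, where the action vanishes.
  refine csInf_le ⟨0, ?_⟩ ⟨γ, hγ, hm⟩
  rintro m' ⟨γ', ⟨-, -, h0, -⟩, hm'⟩
  have h := hm'.2 ⟨0, rfl⟩
  beta_reduce at h
  rwa [action_eq, transverseEnergy_of_ae_eq_zero h0, gradZSq_of_ae_eq_zero h0,
    potential_of_ae_eq_zero hσ h0, mul_zero, mul_zero, add_zero, sub_zero] at h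

/-- A nonzero function at which one of the admissible scaling derivatives vanishes lies above the
mountain pass level. -/
theorem mountainPass_le_of_scalingDeriv_eq_zero {d n : ℕ} (hnd : n < d) {σ : ℝ} (hσ : 0 < σ)
    {u : Space d → ℂ} (hu : MemB1 d n u) (hne : ¬ u =ᵐ[volume] 0) {a b : ℝ}
    (hab : Admissible d n σ a b) (hJ : scalingDeriv d n σ a b u = 0) :
    mountainPass d n σ ≤ action d n σ u := by
  obtain ⟨ha, hb, hp, hσab, -⟩ := hab
  have hact := fun t {θ : ℝ} (hθ : 0 ≤ θ) => action_rescale_exp hnd (σ := σ) hu a b t hθ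
  rw [scalingDeriv_eq hnd hu, sub_eq_zero] at hJ
  have hA := transverseEnergy_nonneg d n u
  have hB : 0 ≤ 1 / 2 * gradZSq d n u := by
    have := gradZSq_nonneg d n u; positivity
  have hC : 0 ≤ 1 / (2 * σ + 2) * potential d σ u := by
    have := potential_nonneg d σ u; positivity
  have hB0 : 1 / 2 * gradZSq d n u ≠ 0 := fun h =>
    hne (ae_eq_zero_of_gradZSq_eq_zero hnd hu (by simpa using h))
  rw [action_eq]
  have hq : 0 < 2 * a + b * ((d : ℝ) - n) - 2 * b := by
    rcases hb.eq_or_lt with rfl | hb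
    · linarith
    · linarith
  have hpq : 2 * a + b * ((d : ℝ) - n) ≤ 2 * a + b * ((d : ℝ) - n) - 2 * b := by linarith
  -- The difference of the two sides is `2(σa + b)`.
  have hqr : 2 * a + b * ((d : ℝ) - n) - 2 * b < (2 * σ + 2) * a + b * ((d : ℝ) - n) := by
    linarith
  generalize transverseEnergy d n u = A at *
  generalize 1 / 2 * gradZSq d n u = B at *
  generalize 1 / (2 * σ + 2) * potential d σ u = C at *
  generalize 2 * a + b * ((d : ℝ) - n) - 2 * b = q at *
  generalize 2 * a + b * ((d : ℝ) - n) = p at *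
  generalize (2 * σ + 2) * a + b * ((d : ℝ) - n) = r at *
  have hr : 0 < r := hq.trans hqr
  have hpr : p < r := hpq.trans_lt hqr
  -- Positivity is read off `rC = pA + qB`; only `qB` is surely positive, since `p` may be zero.
  have hCpos : 0 < C := by
    have hqB : 0 < q * B := mul_pos hq (lt_of_le_of_ne hB (Ne.symm hB0))
    have : 0 < r * C := by rw [← hJ]; positivity
    exact pos_of_mul_pos_right this hr.le
  obtain ⟨t₀, ⟨ht₀p, ht₀q⟩, ht₀⟩ := (((eventually_exp_le hp hpr).and
    (eventually_exp_le hq.le hqr)).and (Filter.eventually_lt_atBot 0)).exists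
  obtain ⟨t₁, ht₁neg, ht₁⟩ := ((eventually_scaled_action_neg (A := A) (B := B) hCpos hpr hqr).and
    (Filter.eventually_gt_atTop 0)).exists
  have hgap : 0 < t₁ - t₀ := by linarith
  -- Two legs: on `[0, 1/2]` the amplitude grows from `0` to `1` at time `t₀`; on `[1/2, 1]` the
  -- time runs from `t₀` to `t₁` at amplitude `1`. The first leg is needed because the orbit need
  -- not tend to `0` as `t → -∞` when `p = 0`.
  set θ : unitInterval → ℝ := fun s => min (2 * (s : ℝ)) 1 with hθ
  set τ : unitInterval → ℝ := fun s => t₀ + max (2 * (s : ℝ) - 1) 0 * (t₁ - t₀) with hτ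
  have hθc : Continuous θ := by fun_prop
  have hτc : Continuous τ := by fun_prop
  have hθ0 : ∀ s, 0 ≤ θ s := fun s => le_min (by have := s.2.1; positivity) zero_le_one
  have hθ1 : ∀ s, θ s ≤ 1 := fun s => min_le_right _ _
  refine mountainPass_le_of_mem_paths hσ
    (γ := fun s => rescale d n (θ s * Real.exp (a * τ s)) (Real.exp (-b * τ s)) u)
    ⟨fun s => hu.rescale hnd _ (Real.exp_pos _), fun s => ?_, ?_, ?_⟩ ⟨?_, ?_⟩
  · refine tendsto_normB1_rescale hnd (Continuous.tendsto ?_ s) (Continuous.tendsto ?_ s)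
      (Real.exp_pos _) hu
    · fun_prop
    · fun_prop
  · refine Filter.Eventually.of_forall fun x => ?_
    simp [rescale, hθ]
  · have e1 : θ 1 = 1 := by simp [hθ]
    have e2 : τ 1 = t₁ := by simp only [hτ, Set.Icc.coe_one]; norm_num
    rw [hact _ (hθ0 1), e1, e2, Real.one_rpow]
    linarith
  -- `w` is the fraction of the second leg at which the time is `0`; there the path passes through
  -- `u` and attains the maximum.
  · set w : ℝ := -t₀ / (t₁ - t₀) with hw
    have hw0 : 0 ≤ w := div_nonneg (by linarith) hgap.le
    have hw1 : w ≤ 1 := by rw [hw, div_le_one hgap]; linarith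
    refine ⟨⟨(1 + w) / 2, by constructor <;> linarith⟩, ?_⟩
    beta_reduce
    rw [hact _ (hθ0 _)]
    have e1 : θ ⟨(1 + w) / 2, by constructor <;> linarith⟩ = 1 := by
      simp only [hθ]; exact min_eq_right (by linarith)
    have e2 : τ ⟨(1 + w) / 2, by constructor <;> linarith⟩ = 0 := by
      simp only [hτ]
      rw [max_eq_left (by linarith), hw]; field_simp; ring
    rw [e1, e2]
    simp
  · rintro _ ⟨s, rfl⟩
    beta_reduce
    rw [hact _ (hθ0 s)]
    rcases le_total (2 * (s : ℝ)) 1 with hs | hs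
    · have e2 : τ s = t₀ := by
        simp only [hτ]; rw [max_eq_right (by linarith)]; ring
      rw [e2]
      -- On the segment the potential is discarded; the choice of `t₀` bounds the quadratic part
      -- alone by `A + B - C`.
      have h1 : θ s ^ 2 * (A * Real.exp (p * t₀) + B * Real.exp (q * t₀)) ≤
          1 * (A * (1 - p / r) + B * (1 - q / r)) := by
        gcongr
        · exact pow_le_one₀ (hθ0 s) (hθ1 s)
      have h2 : 0 ≤ θ s ^ (2 * σ + 2) * (C * Real.exp (r * t₀)) := by
        have := hθ0 s; positivity
      have h3 : A * (1 - p / r) + B * (1 - q / r) = A + B - C := by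
        have : C = (p * A + q * B) / r := by rw [hJ]; field_simp
        rw [this]; field_simp; ring
      linarith
    · have e1 : θ s = 1 := min_eq_right hs
      rw [e1, Real.one_rpow]
      have := scaled_action_le hA hB hp hpr.le hq.le hqr.le hr hJ (τ s)
      linarith

/-! ### Comparison of signs below the mountain pass level. -/

theorem sigma_mul_gt_two {d n : ℕ} (hnd : n < d) {σ : ℝ} (hσ : 2 / ((d : ℝ) - n) < σ) :
    2 < σ * ((d : ℝ) - n) := by
  have hm : (0 : ℝ) < (d : ℝ) - n := sub_pos.2 (by exact_mod_cast hnd)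
  rwa [div_lt_iff₀ hm] at hσ

/-- Every scaling derivative is a combination of the Nehari and virial functionals. -/
theorem scalingDeriv_eq_nehari_virial {d n : ℕ} (hnd : n < d) {σ : ℝ} (hσ : 0 < σ)
    {u : Space d → ℂ} (hu : MemB1 d n u) (a b : ℝ) :
    scalingDeriv d n σ a b u = (2 * a + b * ((d : ℝ) - n)) / 2 * nehari d n σ u +
      -b / 2 * ((d : ℝ) - n) * virial d n σ u := by
  have hm : (0 : ℝ) < (d : ℝ) - n := sub_pos.2 (by exact_mod_cast hnd)
  have h1 : σ + 1 ≠ 0 := by positivity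
  have h2 : 2 * σ + 2 ≠ 0 := by positivity
  rw [scalingDeriv_eq hnd hu, nehari, virial, transverseEnergy, gradSq_eq_add d n]
  generalize (d : ℝ) - n = m at *
  have h3 : 1 / (2 * σ + 2) = 1 / (2 * (σ + 1)) := by ring
  rw [h3]
  field_simp
  ring

/-- For `u ≠ 0`, if either functional vanished or the signs were opposite, some nontrivial
nonnegative combination of the two would be zero, that is, some admissible scaling derivative,
forcing `β ≤ S(u)`. -/
theorem sign_nehari_eq_sign_virial {d n : ℕ} (hnd : n < d) {σ : ℝ}
    (hσ : 2 / ((d : ℝ) - n) < σ) {u : Space d → ℂ} (hu : MemB1 d n u)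
    (hS : action d n σ u < mountainPass d n σ) :
    SignType.sign (nehari d n σ u) = SignType.sign (virial d n σ u) := by
  have hm : (0 : ℝ) < (d : ℝ) - n := sub_pos.2 (by exact_mod_cast hnd)
  have hσ0 : 0 < σ := (by positivity : (0 : ℝ) < 2 / ((d : ℝ) - n)).trans hσ
  have hσm := sigma_mul_gt_two hnd hσ
  by_cases hne : u =ᵐ[volume] 0
  · have hN : nehari d n σ u = 0 := by
      have := transverseEnergy_of_ae_eq_zero (n := n) hne
      rw [transverseEnergy] at this
      rw [nehari, gradSq_eq_add d n, gradZSq_of_ae_eq_zero hne, potential_of_ae_eq_zero hσ0 hne]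
      linarith
    have hV : virial d n σ u = 0 := by
      rw [virial, gradZSq_of_ae_eq_zero hne, potential_of_ae_eq_zero hσ0 hne]; ring
    rw [hN, hV]
  by_contra hsign
  have key : ∀ α θ : ℝ, 0 ≤ α → 0 ≤ θ → 0 < α + θ →
      α * nehari d n σ u + θ * ((d : ℝ) - n) * virial d n σ u ≠ 0 := by
    intro α θ hα hθ hαθ h
    refine hS.not_ge (mountainPass_le_of_scalingDeriv_eq_zero hnd hσ0 hu hne
      -- Solves `(2a + b(d-n))/2 = α` and `-b/2 = θ`. The condition `σa + b > 0` uses `σ(d-n) > 2`,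
      -- decisive when `α = 0`.
      (a := α + θ * ((d : ℝ) - n)) (b := -2 * θ) ?_ ?_)
    · have ha : 0 < α + θ * ((d : ℝ) - n) := by
        rcases hα.eq_or_lt with rfl | hα
        · have : 0 < θ := by linarith
          positivity
        · positivity
      refine ⟨ha, by linarith, by linarith, ?_, fun he => ha.ne' (congrArg Prod.fst he)⟩
      have e : σ * (α + θ * ((d : ℝ) - n)) + -2 * θ = σ * α + θ * (σ * ((d : ℝ) - n) - 2) := by
        ring
      have h2 : 0 < σ * ((d : ℝ) - n) - 2 := by linarith
      rw [e]
      rcases hα.eq_or_lt with rfl | hα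
      · have : 0 < θ := by linarith
        positivity
      · positivity
    · rw [scalingDeriv_eq_nehari_virial hnd hσ0 hu, ← h]
      ring
  refine hsign ?_
  have hN0 : nehari d n σ u ≠ 0 := fun h => key 1 0 (by simp) le_rfl (by simp) (by simp [h])
  have hV0 : virial d n σ u ≠ 0 := fun h => key 0 1 le_rfl (by simp) (by simp) (by simp [h])
  rcases lt_or_gt_of_ne hN0 with hN | hN <;> rcases lt_or_gt_of_ne hV0 with hV | hV
  · rw [sign_neg hN, sign_neg hV]
  -- With opposite signs, each functional provides the coefficient of the other, up to sign and the
  -- factor `d - n`, and the combination cancels.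
  · refine absurd ?_ (key (((d : ℝ) - n) * virial d n σ u) (-nehari d n σ u) (by positivity)
      (by linarith) (add_pos (by positivity) (by linarith)))
    ring
  · refine absurd ?_ (key (((d : ℝ) - n) * -virial d n σ u) (nehari d n σ u)
      (mul_nonneg hm.le (by linarith)) hN.le
      (add_pos (mul_pos hm (by linarith)) (by linarith)))
    ring
  · rw [sign_pos hN, sign_pos hV]

/-- Below the mountain pass level the sign of a scaling derivative is that of the Nehari
functional. -/
theorem scalingDeriv_neg_iff {d n : ℕ} (hnd : n < d) {σ : ℝ}
    (hσ : 2 / ((d : ℝ) - n) < σ) {u : Space d → ℂ} (hu : MemB1 d n u)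
    (hS : action d n σ u < mountainPass d n σ) {a b : ℝ} (hab : Admissible d n σ a b) :
    scalingDeriv d n σ a b u < 0 ↔ nehari d n σ u < 0 := by
  have hm : (0 : ℝ) < (d : ℝ) - n := sub_pos.2 (by exact_mod_cast hnd)
  have hσ0 : 0 < σ := (by positivity : (0 : ℝ) < 2 / ((d : ℝ) - n)).trans hσ
  have hsign := sign_nehari_eq_sign_virial hnd hσ hu hS
  obtain ⟨ha, hb, hp, -, -⟩ := hab
  rw [scalingDeriv_eq_nehari_virial hnd hσ0 hu]
  have hα : 0 ≤ (2 * a + b * ((d : ℝ) - n)) / 2 := by positivity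
  have hθ : 0 ≤ -b / 2 * ((d : ℝ) - n) := mul_nonneg (by linarith) hm.le
  -- The two coefficients add up to `a`, so they are not both zero.
  have hαθ : 0 < (2 * a + b * ((d : ℝ) - n)) / 2 + -b / 2 * ((d : ℝ) - n) := by linarith
  generalize (2 * a + b * ((d : ℝ) - n)) / 2 = α at *
  generalize -b / 2 * ((d : ℝ) - n) = θ at *
  constructor
  · intro h
    by_contra! hN
    have hV : 0 ≤ virial d n σ u := by
      rw [← sign_nonneg_iff, ← hsign, sign_nonneg_iff]; exact hN
    have : 0 ≤ α * nehari d n σ u + θ * virial d n σ u := by positivity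
    linarith
  · intro hN
    have hV : virial d n σ u < 0 := by
      rw [← sign_eq_neg_one_iff, ← hsign, sign_eq_neg_one_iff]; exact hN
    rcases hα.eq_or_lt with rfl | hα
    · have : 0 < θ := by linarith
      nlinarith [mul_neg_of_pos_of_neg this hV]
    · nlinarith [mul_neg_of_pos_of_neg hα hN, mul_nonpos_of_nonneg_of_nonpos hθ hV.le]

end PartialNLS

theorem lemma3p5 (d n : ℕ) (hn : 1 ≤ n) (hnd : n < d) (σ : ℝ)
    (hσ_lower : 2 / ((d : ℝ) - n) < σ) (hσ_upper : σ * ((d : ℝ) - 2) < 2) :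
    (∀ a b a' b' : ℝ, PartialNLS.Admissible d n σ a b → PartialNLS.Admissible d n σ a' b' →
      PartialNLS.Kplus d n σ a b = PartialNLS.Kplus d n σ a' b' ∧
      PartialNLS.Kminus d n σ a b = PartialNLS.Kminus d n σ a' b') ∧
    (∀ u : PartialNLS.Space d → ℂ, PartialNLS.MemB1 d n u →
      PartialNLS.action d n σ u < PartialNLS.mountainPass d n σ →
      SignType.sign (PartialNLS.nehari d n σ u) = SignType.sign (PartialNLS.virial d n σ u)) := by
  have hneg : ∀ {u : PartialNLS.Space d → ℂ} {a b : ℝ}, PartialNLS.MemB1 d n u →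
      PartialNLS.action d n σ u < PartialNLS.mountainPass d n σ →
      PartialNLS.Admissible d n σ a b →
      (PartialNLS.scalingDeriv d n σ a b u < 0 ↔ PartialNLS.nehari d n σ u < 0) :=
    fun hu hS hab => PartialNLS.scalingDeriv_neg_iff hnd hσ_lower hu hS hab
  refine ⟨fun a b a' b' hab hab' => ⟨?_, ?_⟩,
    fun u hu hS => PartialNLS.sign_nehari_eq_sign_virial hnd hσ_lower hu hS⟩
  · ext u
    refine and_congr_right fun hu => and_congr_right fun hS => ?_
    rw [← not_lt, ← not_lt, hneg hu hS hab, hneg hu hS hab']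
  · ext u
    refine and_congr_right fun hu => and_congr_right fun hS => ?_
    rw [hneg hu hS hab, hneg hu hS hab']
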